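/- Let $k\in\mathbb N$. A \emph{$k$-graph} is a countable small category $\Lambda$ (identified with its set of morphisms, called paths, with range and source maps $r,s:\Lambda\to\Lambda^0$; $\mu\nu$ is defined if $s(\mu)=r(\nu)$) with a degree functor $d:\Lambda\to\mathbb N^k$ such that whenever $d(\lambda)=m+n$ there are unique $\mu,\nu\in\Lambda$ with $\lambda=\mu\nu$, $d(\mu)=m$, $d(\nu)=n$. Here $\Lambda^0$ is the set of objects (vertices). For $v\in\Lambda^0$ and $E\subseteq\Lambda$ put $vE=\{\mu\in E: r(\mu)=v\}$ and $Ev=\{\mu\in E: s(\mu)=v\}$. Let $\Lambda^{\min}(\lambda,\mu)$ be the set of pairs $(\alpha,\beta)\in\Lambda\times\Lambda$ with $\lambda\alpha=\mu\beta$ and $d(\lambda\alpha)=d(\lambda)\vee d(\mu)$; $\Lambda$ is \emph{finitely aligned} if all these sets are finite. A set $E\subseteq v\Lambda$ is \emph{exhaustive} if for every $\mu\in v\Lambda$ there is $\lambda\in E$ with $\Lambda^{\min}(\lambda,\mu)\neq\emptyset$. For $m\in(\mathbb N\cup\{\infty\})^k$ let $\Omega_{k,m}$ be the category with objects $\{p\in\mathbb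 N^k:p\le m\}$ and morphisms $\{(p,q): p\le q\le m\}$, where $r(p,q)=p$, $s(p,q)=q$, and with degree $d(p,q)=q-p$. A \emph{boundary path} is a degree-preserving functor $x:\Omega_{k,m}\to\Lambda$, for some $m=:d(x)$, such that for all $n\in\mathbb N^k$ with $n\le d(x)$ and all finite exhaustive $E\subseteq x(n)\Lambda$ there is $\lambda\in E$ with $n+d(\lambda)\le d(x)$ and $x(n,n+d(\lambda))=\lambda$. Let $v\partial\Lambda$ be the set of boundary paths with $x(0)=v$. For $n\le d(x)$ let $\sigma^n x$ be the path of degree $d(x)-n$ with $(\sigma^n x)(p,q)=x(n+p,n+q)$. For $\lambda\in\Lambda x(0)$ let $\lambda x$ be the unique path $y$ with $y(0,d(\lambda))=\lambda$ and $\sigma^{d(\lambda)}y=x$. \textbf{Proposition.} Let $\Lambda$ be a finitely aligned $k$-graph. The following are equivalent: \begin{enumerate} \item ($\Lambda$ has no local periodicity) for every $v\in\Lambda^0$ and all $m\neq n$ in $\mathbb N^k$ there is $x\in v\partial\Lambda$ such that either $d(x)\not\ge m\vee n$ or $\sigma^m x\neq\sigma^n x$; \item ($\Lambda$ satisfies the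 aperiodicity condition) for every $v\in\Lambda^0$ there is $x\in v\partial\Lambda$ such that, for all $m,n\in\mathbb N^k$ with $m,n\le d(x)$, $\sigma^m x=\sigma^n x$ implies $m=n$; \item ($\Lambda$ satisfies Condition B) for every $v\in\Lambda^0$ there is $x\in v\partial\Lambda$ such that $\lambda x\neq\mu x$ for all $\lambda\neq\mu$ in $\Lambda v$. \end{enumerate} -/

import Mathlib

open CategoryTheory

universe u v

/-- A `k`-graph on the category `Λ`: the category is countable and carries a degree functor to the
monoid `ℕ ^ k` with the unique factorization property. A path with source `a` and range `b` is a
morphism `a ⟶ b`, so that the product `μ ν` of paths is the composite `ν ≫ μ`; vertices are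
objects. -/
structure KGraph (k : ℕ) (Λ : Type u) [Category.{v} Λ] where
  countable_obj : Countable Λ
  countable_hom : ∀ a b : Λ, Countable (a ⟶ b)
  /-- The degree of a path. -/
  d : ∀ {a b : Λ}, (a ⟶ b) → (Fin k → ℕ)
  d_id : ∀ a : Λ, d (𝟙 a) = 0
  d_comp : ∀ {a b c : Λ} (f : a ⟶ b) (g : b ⟶ c), d (f ≫ g) = d f + d g
  /-- A path of degree `m + n` is in a unique way a product `μ ν` of a path `μ` of degree `m` and a
  path `ν` of degree `n`. -/
  factor : ∀ {a b : Λ} (f : a ⟶ b) (m n : Fin k → ℕ), d f = m + n →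
    ∃! t : (c : Λ) × ((c ⟶ b) × (a ⟶ c)), t.2.2 ≫ t.2.1 = f ∧ d t.2.1 = m ∧ d t.2.2 = n

namespace KGraph

/-- The inclusion of `ℕ ^ k` in `(ℕ ∪ {∞}) ^ k`. -/
def toENat {k : ℕ} (p : Fin k → ℕ) : Fin k → ℕ∞ := fun i => (p i : ℕ∞)

/-- The objects of the `k`-graph `Ω_{k,m}`, where `m ∈ (ℕ ∪ {∞}) ^ k`: all `p ∈ ℕ ^ k` with
`p ≤ m`. -/
structure Omega {k : ℕ} (m : Fin k → ℕ∞) where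
  val : Fin k → ℕ
  le : toENat val ≤ m

/-- The morphisms of `Ω_{k,m}` are the pairs `(p, q)` with `p ≤ q ≤ m`; the pair `(p, q)` has
range `p` and source `q`. -/
instance Omega.category {k : ℕ} (m : Fin k → ℕ∞) : Category.{0} (Omega m) where
  Hom q p := PLift (p.val ≤ q.val)
  id _ := ⟨le_rfl⟩
  comp f g := ⟨g.down.trans f.down⟩

/-- The vertex `0` of `Ω_{k,m}`. -/
def Omega.zero {k : ℕ} (m : Fin k → ℕ∞) : Omega m := ⟨0, fun i => by simp [toENat]⟩

/-- The morphism `(0, p)` of `Ω_{k,m}`. -/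
def Omega.toZero {k : ℕ} {m : Fin k → ℕ∞} (p : Omega m) : p ⟶ Omega.zero m :=
  ⟨fun _ => Nat.zero_le _⟩

/-- The map `p ↦ n + p` from `Ω_{k,m-n}` to `Ω_{k,m}`, for `n ≤ m`. -/
def Omega.translate {k : ℕ} (m : Fin k → ℕ∞) (n : Fin k → ℕ) (h : toENat n ≤ m) :
    Omega (m - toENat n) ⥤ Omega m where
  obj p := ⟨n + p.val, fun i => by
    have h1 := p.le i
    have h2 := add_le_add_right h1 (toENat n i)
    rw [Pi.sub_apply, add_tsub_cancel_of_le (h i)] at h2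
    simpa [toENat] using h2⟩
  map f := ⟨add_le_add le_rfl f.down⟩

variable {k : ℕ} {Λ : Type u} [Category.{v} Λ]

/-- `Λ^min(f, g)` for paths `f` and `g` with a common range: all pairs of paths `(α, β)` such that
`f α = g β` has degree `d f ∨ d g`. (For paths with different ranges there are no such pairs.) -/
def minExt (G : KGraph k Λ) {a b c : Λ} (f : a ⟶ c) (g : b ⟶ c) :
    Set ((e : Λ) × ((e ⟶ a) × (e ⟶ b))) :=
  {t | t.2.1 ≫ f = t.2.2 ≫ g ∧ G.d (t.2.1 ≫ f) = G.d f ⊔ G.d g}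

def FinitelyAligned (G : KGraph k Λ) : Prop :=
  ∀ ⦃a b c : Λ⦄ (f : a ⟶ c) (g : b ⟶ c), (G.minExt f g).Finite

/-- A set `E` of paths with range `w` is exhaustive. -/
def Exhaustive (G : KGraph k Λ) {w : Λ} (E : Set ((a : Λ) × (a ⟶ w))) : Prop :=
  ∀ ⦃b : Λ⦄ (g : b ⟶ w), ∃ f ∈ E, (G.minExt f.2 g).Nonempty

/-- `X_Λ`: the graph morphisms (degree-preserving functors) `x : Ω_{k,m} → Λ`, where `m = d(x)`
ranges over `(ℕ ∪ {∞}) ^ k`. -/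
structure Path (G : KGraph k Λ) where
  deg : Fin k → ℕ∞
  toFunctor : Omega deg ⥤ Λ
  d_map : ∀ {q p : Omega deg} (f : q ⟶ p), G.d (toFunctor.map f) = q.val - p.val

namespace Path

variable {G : KGraph k Λ}

/-- The vertex `x(n)`. -/
abbrev vertex (x : G.Path) (n : Fin k → ℕ) (h : toENat n ≤ x.deg) : Λ := x.toFunctor.obj ⟨n, h⟩

/-- The path `x(m, n)`, for `m ≤ n ≤ d(x)`. -/
def segment (x : G.Path) (m n : Fin k → ℕ) (hm : toENat m ≤ x.deg) (hn : toENat n ≤ x.deg)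
    (h : m ≤ n) : x.vertex n hn ⟶ x.vertex m hm :=
  x.toFunctor.map (X := ⟨n, hn⟩) (Y := ⟨m, hm⟩) ⟨h⟩

/-- The range `x(0)`. -/
abbrev range (x : G.Path) : Λ := x.toFunctor.obj (Omega.zero x.deg)

/-- The shift `σ^n x`, for `n ≤ d(x)`: the path of degree `d(x) - n` with
`(σ^n x)(p, q) = x(n + p, n + q)`. -/
def shift (x : G.Path) (n : Fin k → ℕ) (h : toENat n ≤ x.deg) : G.Path where
  deg := x.deg - toENat n
  toFunctor := Omega.translate x.deg n h ⋙ x.toFunctor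
  d_map f := by
    rw [Functor.comp_map, x.d_map]
    exact add_tsub_add_eq_tsub_left _ _ _

/-- `x ∈ ∂Λ`: for all `n ≤ d(x)` and all finite exhaustive `E ⊆ x(n)Λ` there is `f ∈ E` with
`x(n, n + d(f)) = f`. -/
def IsBoundary (x : G.Path) : Prop :=
  ∀ (n : Fin k → ℕ) (hn : toENat n ≤ x.deg) (E : Set ((a : Λ) × (a ⟶ x.vertex n hn))),
    E.Finite → G.Exhaustive E →
      ∃ f ∈ E, ∃ h : toENat (n + G.d f.2) ≤ x.deg,
        (⟨x.vertex (n + G.d f.2) h,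
          x.segment n (n + G.d f.2) hn h le_self_add⟩ : (a : Λ) × (a ⟶ x.vertex n hn)) = f

/-- `y` is the concatenation `f x`: `y(0, d(f)) = f` and `σ^{d(f)} y = x`. -/
def IsConcat {w : Λ} (x : G.Path) (f : x.range ⟶ w) (y : G.Path) : Prop :=
  ∃ h : toENat (G.d f) ≤ y.deg,
    Arrow.mk (y.toFunctor.map (Omega.toZero ⟨G.d f, h⟩)) = Arrow.mk f ∧ y.shift (G.d f) h = x

end Path

section Concatenation

variable {k : ℕ} {Λ : Type u} [Category.{v} Λ]

theorem cancel (G : KGraph k Λ) {a b c : Λ} {f g : a ⟶ b} {h : b ⟶ c} (e : f ≫ h = g ≫ h) : f = g := by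
  have hd : G.d f = G.d g := by
    have := congrArg G.d e
    rw [G.d_comp, G.d_comp] at this
    exact add_right_cancel this
  have hu := (G.factor (f ≫ h) (G.d h) (G.d f) (by rw [G.d_comp, add_comm])).unique
    (y₁ := ⟨b, h, f⟩) (y₂ := ⟨b, h, g⟩) ⟨rfl, rfl, rfl⟩ ⟨e.symm, rfl, hd.symm⟩
  simpa using hu

/-- Two factorizations of the same path, the first through the longer initial segment. -/
theorem exists_between (G : KGraph k Λ) {a b c c' : Λ} {h : c ⟶ b} {t : a ⟶ c} {h' : c' ⟶ b} {t' : a ⟶ c'}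
    (e : t ≫ h = t' ≫ h') (hle : G.d h' ≤ G.d h) : ∃ g : c ⟶ c', g ≫ h' = h := by
  obtain ⟨⟨e1, h1, g1⟩, ⟨hh, hd, -⟩, -⟩ :=
    G.factor h (G.d h') (G.d h - G.d h') (add_tsub_cancel_of_le hle).symm
  dsimp only at hh hd
  have key : G.d t' = G.d (t ≫ g1) := by
    have h2 := congrArg G.d e
    rw [← hh, G.d_comp, G.d_comp, G.d_comp, hd, ← add_assoc] at h2
    rw [G.d_comp]
    exact (add_right_cancel h2).symm
  have hu := (G.factor (t ≫ h) (G.d h') (G.d t') (by rw [e, G.d_comp, add_comm])).unique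
    (y₁ := ⟨e1, h1, t ≫ g1⟩) (y₂ := ⟨c', h', t'⟩)
    ⟨by simp [hh], hd, key.symm⟩ ⟨e.symm, rfl, rfl⟩
  cases hu
  exact ⟨g1, hh⟩

theorem initial_unique (G : KGraph k Λ) {a b c a' b' c' : Λ} {g : a ⟶ c} {h : c ⟶ b}
    {g' : a' ⟶ c'} {h' : c' ⟶ b'} (e : Arrow.mk (g ≫ h) = Arrow.mk (g' ≫ h'))
    (hh : G.d h = G.d h') (hg : G.d g = G.d g') : Arrow.mk h = Arrow.mk h' := by
  obtain ⟨h1, h2, h3⟩ := (Arrow.mk_eq_mk_iff _ _).1 e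
  subst h1 h2
  have hu := (G.factor (g' ≫ h') (G.d h') (G.d g') (by rw [G.d_comp, add_comm])).unique
    (y₁ := ⟨c, h, g⟩) (y₂ := ⟨c', h', g'⟩) ⟨by simpa using h3, hh, hg⟩ ⟨rfl, rfl, rfl⟩
  cases hu
  rfl

theorem terminal_unique (G : KGraph k Λ) {a b c a' b' c' : Λ} {g : a ⟶ c} {h : c ⟶ b}
    {g' : a' ⟶ c'} {h' : c' ⟶ b'} (e : Arrow.mk (g ≫ h) = Arrow.mk (g' ≫ h'))
    (hh : G.d h = G.d h') (hg : G.d g = G.d g') : Arrow.mk g = Arrow.mk g' := by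
  obtain ⟨h1, h2, h3⟩ := (Arrow.mk_eq_mk_iff _ _).1 e
  subst h1 h2
  have hu := (G.factor (g' ≫ h') (G.d h') (G.d g') (by rw [G.d_comp, add_comm])).unique
    (y₁ := ⟨c, h, g⟩) (y₂ := ⟨c', h', g'⟩) ⟨by simpa using h3, hh, hg⟩ ⟨rfl, rfl, rfl⟩
  cases hu
  rfl

theorem mk_eq_mk_id_of_d_eq_zero (G : KGraph k Λ) {a b : Λ} {h : a ⟶ b} (hh : G.d h = 0) :
    Arrow.mk h = Arrow.mk (𝟙 a) ∧ Arrow.mk h = Arrow.mk (𝟙 b) := by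
  have hu := (G.factor h 0 0 (by simp [hh])).unique
    (y₁ := ⟨b, 𝟙 b, h⟩) (y₂ := ⟨a, h, 𝟙 a⟩) ⟨by simp, G.d_id b, hh⟩ ⟨by simp, hh, G.d_id a⟩
  obtain rfl : b = a := congrArg Sigma.fst hu
  simp only [Sigma.mk.injEq, heq_eq_eq, true_and, Prod.mk.injEq] at hu
  rw [hu.2]
  exact ⟨rfl, rfl⟩

theorem comp_eq_left (G : KGraph k Λ) {a b c : Λ} (g : a ⟶ b) {h : b ⟶ c} (hh : G.d h = 0) :
    Arrow.mk (g ≫ h) = Arrow.mk g := by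
  obtain ⟨h1, h2, h3⟩ := (Arrow.mk_eq_mk_iff _ _).1 (G.mk_eq_mk_id_of_d_eq_zero hh).1
  subst h2
  rw [h3]
  simp

theorem comp_eq_right (G : KGraph k Λ) {a b c : Λ} {g : a ⟶ b} (h : b ⟶ c) (hg : G.d g = 0) :
    Arrow.mk (g ≫ h) = Arrow.mk h := by
  obtain ⟨h1, h2, h3⟩ := (Arrow.mk_eq_mk_iff _ _).1 (G.mk_eq_mk_id_of_d_eq_zero hg).2
  subst h1
  rw [h3]
  simp

namespace Path

variable {G : KGraph k Λ}

theorem eqToHom_eq_map {m : Fin k → ℕ∞} (F : Omega m ⥤ Λ) {p q : Omega m}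
    (e : p.val = q.val) (h : F.obj p = F.obj q) : eqToHom h = F.map ⟨e.ge⟩ := by
  obtain ⟨p, hp⟩ := p
  obtain ⟨q, hq⟩ := q
  obtain rfl : p = q := e
  exact (F.map_id _).symm

theorem eq_of_initial_eq {x y : G.Path} (hd : x.deg = y.deg)
    (h : ∀ p (hx : toENat p ≤ x.deg) (hy : toENat p ≤ y.deg),
      Arrow.mk (x.toFunctor.map (Omega.toZero ⟨p, hx⟩)) =
        Arrow.mk (y.toFunctor.map (Omega.toZero ⟨p, hy⟩))) : x = y := by
  obtain ⟨m, F, hF⟩ := x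
  obtain ⟨m', F', hF'⟩ := y
  obtain rfl : m = m' := hd
  dsimp only at h
  have hmap : ∀ p : Omega m, ∃ (h1 : F.obj p = F'.obj p)
      (h2 : F'.obj (Omega.zero m) = F.obj (Omega.zero m)),
      F.map (Omega.toZero p) = eqToHom h1 ≫ F'.map (Omega.toZero p) ≫ eqToHom h2 := by
    intro p
    obtain ⟨h1, h2, h3⟩ := (Arrow.mk_eq_mk_iff _ _).1 (h p.val p.le p.le)
    exact ⟨h1, h2.symm, h3⟩
  have hFF : F = F' := by
    have hobj : ∀ p, F.obj p = F'.obj p := fun p => (hmap p).1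
    refine CategoryTheory.Functor.ext hobj fun q p f => ?_
    apply G.cancel (h := F.map (Omega.toZero p))
    rw [← F.map_comp]
    obtain ⟨_, a2, a3⟩ := hmap p
    obtain ⟨_, b2, b3⟩ := hmap q
    have e : F'.map (Omega.toZero q) = F'.map f ≫ F'.map (Omega.toZero p) := by
      rw [← F'.map_comp]; rfl
    refine b3.trans ?_
    rw [e, a3]
    simp
  subst hFF
  rfl

theorem initial_of_shift_eq {y : G.Path} {n : Fin k → ℕ} {h : toENat n ≤ y.deg} {x : G.Path}
    (hx : y.shift n h = x) {w : Λ} (f : x.range ⟶ w)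
    (hf : Arrow.mk (y.toFunctor.map (Omega.toZero ⟨n, h⟩)) = Arrow.mk f)
    (p : Fin k → ℕ) (hp : toENat p ≤ x.deg) (hq : toENat (n + p) ≤ y.deg) :
    Arrow.mk (y.toFunctor.map (Omega.toZero ⟨n + p, hq⟩)) =
      Arrow.mk (x.toFunctor.map (Omega.toZero ⟨p, hp⟩) ≫ f) := by
  subst hx
  obtain ⟨h1, h2, h3⟩ := (Arrow.mk_eq_mk_iff _ _).1 hf
  subst h2
  have h4 : f = eqToHom h1.symm ≫ y.toFunctor.map (Omega.toZero ⟨n, h⟩) := by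
    rw [h3]; simp
  have h5 : eqToHom h1.symm =
      y.toFunctor.map (X := ⟨n + 0, by simpa using h⟩) (Y := ⟨n, h⟩) ⟨by simp⟩ :=
    eqToHom_eq_map y.toFunctor (p := ⟨n + 0, by simpa using h⟩) (q := ⟨n, h⟩) (by simp) h1.symm
  rw [h4, h5]
  congr 1
  have h6 : y.toFunctor.map (Omega.toZero ⟨n + p, hq⟩) =
      y.toFunctor.map (X := ⟨n + p, hq⟩) (Y := ⟨n + 0, by simpa using h⟩) ⟨by simp⟩ ≫
        y.toFunctor.map (X := ⟨n + 0, by simpa using h⟩) (Y := ⟨n, h⟩) ⟨by simp⟩ ≫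
          y.toFunctor.map (Omega.toZero ⟨n, h⟩) := by
    rw [← y.toFunctor.map_comp, ← y.toFunctor.map_comp]
    rfl
  exact h6

theorem IsConcat.deg_eq {w : Λ} {x : G.Path} {f : x.range ⟶ w} {y : G.Path}
    (h : x.IsConcat f y) : y.deg = toENat (G.d f) + x.deg := by
  obtain ⟨h1, -, h3⟩ := h
  have h4 : y.deg - toENat (G.d f) = x.deg := congrArg Path.deg h3
  rw [← h4]
  funext i
  exact (add_tsub_cancel_of_le (h1 i)).symm

theorem IsConcat.unique {w : Λ} {x : G.Path} {f : x.range ⟶ w} {y z : G.Path}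
    (hy : x.IsConcat f y) (hz : x.IsConcat f z) : y = z := by
  have hdy := hy.deg_eq
  have hdz := hz.deg_eq
  obtain ⟨y1, y2, y3⟩ := hy
  obtain ⟨z1, z2, z3⟩ := hz
  refine eq_of_initial_eq (hdy.trans hdz.symm) fun p py pz => ?_
  have hp : toENat (p - G.d f) ≤ x.deg := by
    intro i
    have := py i
    rw [hdy] at this
    simpa [toENat, add_comm] using this
  have hq : toENat (G.d f + (p - G.d f)) ≤ toENat (G.d f) + x.deg := by
    intro i
    have := add_le_add_right (hp i) (toENat (G.d f) i)
    simpa [toENat] using this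
  have hpq : p ≤ G.d f + (p - G.d f) := le_add_tsub
  have hyz := (initial_of_shift_eq y3 f y2 _ hp (hdy ▸ hq)).trans
    (initial_of_shift_eq z3 f z2 _ hp (hdz ▸ hq)).symm
  let gy := y.toFunctor.map (X := ⟨G.d f + (p - G.d f), hdy ▸ hq⟩) (Y := ⟨p, py⟩) ⟨hpq⟩
  let gz := z.toFunctor.map (X := ⟨G.d f + (p - G.d f), hdz ▸ hq⟩) (Y := ⟨p, pz⟩) ⟨hpq⟩
  have dgy : G.d gy = G.d f + (p - G.d f) - p := y.d_map _
  have dgz : G.d gz = G.d f + (p - G.d f) - p := z.d_map _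
  let ty := y.toFunctor.map (Omega.toZero ⟨p, py⟩)
  let tz := z.toFunctor.map (Omega.toZero ⟨p, pz⟩)
  have ey : y.toFunctor.map (Omega.toZero ⟨G.d f + (p - G.d f), hdy ▸ hq⟩) = gy ≫ ty := by
    rw [← y.toFunctor.map_comp]; rfl
  have ez : z.toFunctor.map (Omega.toZero ⟨G.d f + (p - G.d f), hdz ▸ hq⟩) = gz ≫ tz := by
    rw [← z.toFunctor.map_comp]; rfl
  have dty : G.d ty = p := by simp only [ty, y.d_map]; exact tsub_zero _
  have dtz : G.d tz = p := by simp only [tz, z.d_map]; exact tsub_zero _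
  rw [ey, ez] at hyz
  exact G.initial_unique hyz (dty.trans dtz.symm) (dgy.trans dgz.symm)

/-- Concatenations exist: the initial segment of degree `p` of `f x` is the initial segment of
degree `p` of the finite path `f x(0, q)`, where `q` is the positive part of `p - d(f)`. -/
theorem exists_isConcat {w : Λ} (x : G.Path) (f : x.range ⟶ w) : ∃ y, x.IsConcat f y := by
  let m : Fin k → ℕ∞ := toENat (G.d f) + x.deg
  have hlow : ∀ p : Omega m, toENat (p.val - G.d f) ≤ x.deg := by
    intro p i
    have := p.le i
    simpa [toENat, m, add_comm] using this
  let low : Omega m → Omega x.deg := fun p => ⟨p.val - G.d f, hlow p⟩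
  have dlong : ∀ p : Omega m, G.d (x.toFunctor.map (Omega.toZero (low p)) ≫ f) =
      p.val + (p.val - G.d f + G.d f - p.val) := by
    intro p
    rw [G.d_comp, x.d_map, add_tsub_cancel_of_le le_tsub_add]
    rfl
  choose t ht using fun p => (G.factor _ _ _ (dlong p)).exists
  have hstep : ∀ q p : Omega m, p.val ≤ q.val →
      ∃ g : (t q).1 ⟶ (t p).1, g ≫ (t p).2.1 = (t q).2.1 := by
    intro q p hpq
    have hl : (low p).val ≤ (low q).val := tsub_le_tsub_right hpq _
    refine G.exists_between (t := (t q).2.2)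
      (t' := x.toFunctor.map (X := low q) (Y := low p) ⟨hl⟩ ≫ (t p).2.2) ?_ ?_
    · rw [(ht q).1, Category.assoc, (ht p).1, ← Category.assoc, ← x.toFunctor.map_comp]
      rfl
    · rw [(ht q).2.1, (ht p).2.1]
      exact hpq
  choose g hg using hstep
  let F : Omega m ⥤ Λ :=
    { obj := fun p => (t p).1
      map := fun {q p} e => g q p e.down
      map_id := fun p => G.cancel (h := (t p).2.1) (by rw [hg, Category.id_comp])
      map_comp := fun {a b c} e e' => G.cancel (h := (t c).2.1) (by
        rw [hg, Category.assoc, hg, hg]) }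
  have hF : ∀ {q p : Omega m} (e : q ⟶ p), F.map e ≫ (t p).2.1 = (t q).2.1 :=
    fun e => hg _ _ e.down
  let y : G.Path :=
    { deg := m
      toFunctor := F
      d_map := fun {q p} e => by
        have := congrArg G.d (hF e)
        rw [G.d_comp, (ht q).2.1, (ht p).2.1] at this
        rw [← this, add_tsub_cancel_right] }
  have hinit : ∀ p : Omega m, G.d f ≤ p.val →
      Arrow.mk (t p).2.1 = Arrow.mk (x.toFunctor.map (Omega.toZero (low p)) ≫ f) := by
    intro p hp
    rw [← (ht p).1]
    refine (G.comp_eq_right _ ?_).symm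
    rw [(ht p).2.2, tsub_add_cancel_of_le hp, tsub_self]
  have hlow0 : ∀ p : Omega m, p.val = G.d f → Arrow.mk (t p).2.1 = Arrow.mk f := by
    intro p hp
    rw [hinit p hp.ge]
    refine G.comp_eq_right _ ?_
    rw [x.d_map]
    funext i
    simp [low, hp]
  have h : toENat (G.d f) ≤ m := fun i => le_self_add
  refine ⟨y, h, ?_, ?_⟩
  · rw [← hlow0 ⟨G.d f, h⟩ rfl, ← hF (Omega.toZero _)]
    exact (G.comp_eq_left _ (ht _).2.1).symm
  · refine eq_of_initial_eq ?_ fun q h1 h2 => ?_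
    · funext i
      change toENat (G.d f) i + x.deg i - toENat (G.d f) i = x.deg i
      exact (ENat.addLECancellable_of_ne_top (ENat.natCast_ne_top _)).add_tsub_cancel_left
    · have hp : toENat (G.d f + q) ≤ m := by
        intro i
        have := add_le_add_right (h2 i) (toENat (G.d f) i)
        simpa [toENat, m] using this
      have hp0 : toENat (G.d f + 0) ≤ m := by simpa using h
      have hl : low ⟨G.d f + q, hp⟩ = ⟨q, h2⟩ := by simp [low]
      have hl' : ∀ r : Omega x.deg, r = ⟨q, h2⟩ →
          Arrow.mk (x.toFunctor.map (Omega.toZero r) ≫ f) =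
            Arrow.mk (x.toFunctor.map (Omega.toZero ⟨q, h2⟩) ≫ f) := by
        rintro _ rfl
        rfl
      have e := (hinit ⟨G.d f + q, hp⟩ le_self_add).trans (hl' _ hl)
      rw [← hF (p := ⟨G.d f + 0, hp0⟩) ⟨add_le_add le_rfl (fun _ => Nat.zero_le _)⟩] at e
      refine G.terminal_unique e ?_ ?_
      · exact (ht ⟨G.d f + 0, hp0⟩).2.1.trans (add_zero _)
      · exact ((y.shift (G.d f) h).d_map _).trans (x.d_map (Omega.toZero ⟨q, h2⟩)).symm

/-- The path `f x`, for a path `f` with source `x(0)`: the unique path `y` in `X_Λ` with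
`y(0, d(f)) = f` and `σ^{d(f)} y = x`; its degree is `d(f) + d(x)`. -/
noncomputable def concat {w : Λ} (x : G.Path) (f : x.range ⟶ w) : G.Path := (x.exists_isConcat f).choose

theorem isConcat_concat {w : Λ} (x : G.Path) (f : x.range ⟶ w) : x.IsConcat f (x.concat f) :=
  (x.exists_isConcat f).choose_spec

end Path

end Concatenation

section Conditions

variable {k : ℕ} {Λ : Type u} [Category.{v} Λ]

/-- For every vertex `w` and all `m ≠ n` there is `x ∈ w∂Λ` such that `d(x) ≱ m ∨ n` or
`σ^m x ≠ σ^n x`. -/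
def NoLocalPeriodicity (G : KGraph k Λ) : Prop :=
  ∀ (w : Λ) (m n : Fin k → ℕ), m ≠ n →
    ∃ x : G.Path, x.IsBoundary ∧ x.range = w ∧
      (¬ toENat (m ⊔ n) ≤ x.deg ∨
        ∃ (hm : toENat m ≤ x.deg) (hn : toENat n ≤ x.deg), x.shift m hm ≠ x.shift n hn)

/-- For every vertex `w` there is `x ∈ w∂Λ` such that, for all `m, n ≤ d(x)`,
`σ^m x = σ^n x` implies `m = n`. -/
def AperiodicityCondition (G : KGraph k Λ) : Prop :=
  ∀ w : Λ, ∃ x : G.Path, x.IsBoundary ∧ x.range = w ∧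
    ∀ (m n : Fin k → ℕ) (hm : toENat m ≤ x.deg) (hn : toENat n ≤ x.deg),
      x.shift m hm = x.shift n hn → m = n

/-- For every vertex `w` there is `x ∈ w∂Λ` such that `f x ≠ g x` for all `f ≠ g` in `Λw`, that
is, for any two different paths `f` and `g` with source `w = x(0)`, whatever their ranges. -/
def ConditionB (G : KGraph k Λ) : Prop :=
  ∀ w : Λ, ∃ x : G.Path, x.IsBoundary ∧ x.range = w ∧
    ∀ ⦃a b : Λ⦄ (f : x.range ⟶ a) (g : x.range ⟶ b),
      Arrow.mk f ≠ Arrow.mk g → x.concat f ≠ x.concat g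

end Conditions

end KGraph

/-!
A path `x` is determined by the finite paths which are its initial segments (`Path.StartsWith`), and
shifts, concatenations and the boundary condition are all expressed through them
(`Path.StartsWith.startsWith_shift_iff`, `Path.shift_eq_shift_iff`, `Path.IsConcat.startsWith_iff`,
`Path.isBoundary_iff`). The three conditions are then compared as follows.

If `x` is aperiodic and `f x = g x`, let `h` and `h'` be the paths with `f h = g h'` the initial
segment of degree `d(f) ∨ d(g)`. Then `σ^{d(h)} x = σ^{d(h')} x`, so that `d(h) = d(h')`, and `f =
g`.

If `σ^m x = σ^n x` for all `x ∈ w∂Λ`, take a path `f` of degree `m` with range `w` and any boundary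
path `z` with range `s(f)`. With `g = (f z)(0, n)`, one has `z = σ^m (f z) = σ^n (f z)` and so `f z
= g z`. For `m ≠ n` this contradicts Condition B at `s(f)`.

That the absence of local periodicity yields an aperiodic path is a Baire category argument. Among
the boundary paths of degree at least `m ∨ n`, those with `σ^m x = σ^n x` form a closed set; this is
where finite alignment is used (`Path.IsBoundary.startsWith_of_forall_extension`). The set has empty
interior: if it contained all `f y` with `y ∈ s(f)∂Λ` for some `f` of degree at least `m ∨ n`, all
these `y` would satisfy `σ^{m - m ∧ n} y = σ^{n - m ∧ n} y` (`Path.shift_eq_shift_of_isConcat`),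
which is local periodicity at `s(f)`. So the finite paths which exclude the periodicity for `m` and
`n`, or have no extension of degree at least `m ∨ n`, are cofinal with respect to extension, as are
those which decide an instance of the boundary condition. There are countably many such requirements, since `Λ` is countable, and a path which
meets all of them (`exists_path_of_countable_cofinal`) is an aperiodic boundary path.
-/

namespace KGraph

variable {k : ℕ} {Λ : Type u} [Category.{v} Λ]

/-! ### Common extensions of finite paths -/

theorem toENat_le_toENat {p q : Fin k → ℕ} : toENat p ≤ toENat q ↔ p ≤ q := by
  simp [Pi.le_def, toENat]

/-- Every common extension of two paths factors through a minimal one. -/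
theorem exists_minimal_extension (G : KGraph k Λ) {a b c e : Λ} {f : a ⟶ c} {g : b ⟶ c}
    {t : e ⟶ a} {t' : e ⟶ b} (h : t ≫ f = t' ≫ g) :
    ∃ (e' : Λ) (α : e' ⟶ a) (β : e' ⟶ b) (s : e ⟶ e'), α ≫ f = β ≫ g ∧
      G.d (α ≫ f) = G.d f ⊔ G.d g ∧ s ≫ α = t ∧ s ≫ β = t' := by
  have hf : G.d f ≤ G.d (t ≫ f) := by rw [G.d_comp]; exact le_add_self
  have hg : G.d g ≤ G.d (t ≫ f) := by rw [h, G.d_comp]; exact le_add_self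
  obtain ⟨⟨e', F, s⟩, ⟨h1, h2, -⟩, -⟩ := G.factor (t ≫ f) (G.d f ⊔ G.d g)
    (G.d (t ≫ f) - (G.d f ⊔ G.d g)) (add_tsub_cancel_of_le (sup_le hf hg)).symm
  dsimp only at h1 h2
  obtain ⟨α, hα⟩ := G.exists_between h1 (h2 ▸ le_sup_left)
  obtain ⟨β, hβ⟩ := G.exists_between (h1.trans h) (h2 ▸ le_sup_right)
  refine ⟨e', α, β, s, hα.trans hβ.symm, by rw [hα, h2], ?_, ?_⟩
  · exact G.cancel (h := f) (by rw [Category.assoc, hα, h1])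
  · exact G.cancel (h := g) (by rw [Category.assoc, hβ, h1, h])

theorem minExt_nonempty (G : KGraph k Λ) {a b c e : Λ} {f : a ⟶ c} {g : b ⟶ c}
    {t : e ⟶ a} {t' : e ⟶ b} (h : t ≫ f = t' ≫ g) : (G.minExt f g).Nonempty := by
  obtain ⟨e', α, β, -, h1, h2, -⟩ := G.exists_minimal_extension h
  exact ⟨⟨e', α, β⟩, h1, h2⟩

theorem exists_factor (G : KGraph k Λ) {a b : Λ} (f : a ⟶ b) {m : Fin k → ℕ} (hm : m ≤ G.d f) :
    ∃ (c : Λ) (h : c ⟶ b) (g : a ⟶ c), g ≫ h = f ∧ G.d h = m := by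
  obtain ⟨⟨c, h, g⟩, ⟨h1, h2, -⟩, -⟩ := G.factor f m (G.d f - m) (add_tsub_cancel_of_le hm).symm
  exact ⟨c, h, g, h1, h2⟩

theorem sigma_mk_eq_of_arrow_eq {a b : Λ} {f : a ⟶ b} {g : (c : Λ) × (c ⟶ b)}
    (h : Arrow.mk f = Arrow.mk g.2) : (⟨a, f⟩ : (c : Λ) × (c ⟶ b)) = g := by
  obtain ⟨c, g⟩ := g
  obtain ⟨h1, h2, h3⟩ := (Arrow.mk_eq_mk_iff _ _).1 h
  dsimp only at h1 h3
  subst h1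
  simp [h3]

/-- If `E` is finite exhaustive, then so is the set of the minimal paths `β` for which the path `t β`,
that is `β ≫ t`, extends an element of `E`. -/
theorem Exhaustive.exists_pullback {G : KGraph k Λ} (hG : G.FinitelyAligned) {a b : Λ}
    {E : Set ((c : Λ) × (c ⟶ a))} (hE : E.Finite) (hE' : G.Exhaustive E) (t : b ⟶ a) :
    ∃ E' : Set ((c : Λ) × (c ⟶ b)), E'.Finite ∧ G.Exhaustive E' ∧
      ∀ β ∈ E', ∃ g ∈ E, ∃ γ : β.1 ⟶ g.1, β.2 ≫ t = γ ≫ g.2 := by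
  refine ⟨⋃ g ∈ E, (fun s : (e : Λ) × ((e ⟶ b) × (e ⟶ g.1)) => ⟨s.1, s.2.1⟩) '' G.minExt t g.2,
    hE.biUnion fun g _ => (hG t g.2).image _, ?_, ?_⟩
  · intro c l
    obtain ⟨g, hg, ⟨e, p, q⟩, h1, -⟩ := hE' (l ≫ t)
    dsimp only at h1
    obtain ⟨e', α, β, s, h2, h3, h4, -⟩ := G.exists_minimal_extension
      (f := t) (g := g.2) (t := q ≫ l) (t' := p) (by rw [Category.assoc, h1])
    refine ⟨⟨e', α⟩, Set.mem_biUnion hg ⟨⟨e', α, β⟩, ⟨h2, h3⟩, rfl⟩, ?_⟩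
    exact G.minExt_nonempty (t := s) (t' := q) h4
  · intro β hβ
    obtain ⟨g, hg, ⟨e, p, q⟩, ⟨h1, -⟩, rfl⟩ := Set.mem_iUnion₂.1 hβ
    exact ⟨g, hg, q, h1⟩

/-! ### Initial segments -/

namespace Path

variable {G : KGraph k Λ}

/-- The finite path `f` is an initial segment `x(0, p)` of `x`. Since `f` has arbitrary endpoints,
this is an equality of arrows of `Λ`. -/
def StartsWith (x : G.Path) {a b : Λ} (f : a ⟶ b) : Prop :=
  ∃ p : Omega x.deg, Arrow.mk (x.toFunctor.map (Omega.toZero p)) = Arrow.mk f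

variable {x y : G.Path}

theorem d_map_toZero (x : G.Path) (p : Omega x.deg) :
    G.d (x.toFunctor.map (Omega.toZero p)) = p.val :=
  (x.d_map _).trans (tsub_zero _)

theorem startsWith_map (x : G.Path) (p : Omega x.deg) :
    x.StartsWith (x.toFunctor.map (Omega.toZero p)) := ⟨p, rfl⟩

theorem StartsWith.range_eq {a b : Λ} {f : a ⟶ b} (h : x.StartsWith f) : x.range = b := by
  obtain ⟨p, hp⟩ := h
  cases hp
  rfl

theorem StartsWith.d_le {a b : Λ} {f : a ⟶ b} (h : x.StartsWith f) : toENat (G.d f) ≤ x.deg := by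
  obtain ⟨p, hp⟩ := h
  cases hp
  rw [d_map_toZero]
  exact p.le

theorem exists_startsWith (x : G.Path) {p : Fin k → ℕ} (hp : toENat p ≤ x.deg) :
    ∃ (a : Λ) (f : a ⟶ x.range), x.StartsWith f ∧ G.d f = p :=
  ⟨_, _, x.startsWith_map ⟨p, hp⟩, x.d_map_toZero _⟩

theorem StartsWith.exists_comp_eq {a b c : Λ} {f : a ⟶ c} {g : b ⟶ c} (hf : x.StartsWith f)
    (hg : x.StartsWith g) (h : G.d f ≤ G.d g) : ∃ t : b ⟶ a, t ≫ f = g := by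
  obtain ⟨p, hp⟩ := hf
  obtain ⟨q, hq⟩ := hg
  cases hp
  cases hq
  rw [d_map_toZero, d_map_toZero] at h
  exact ⟨x.toFunctor.map (X := q) (Y := p) ⟨h⟩, (x.toFunctor.map_comp _ _).symm⟩

theorem StartsWith.arrow_eq {a b a' b' : Λ} {f : a ⟶ b} {g : a' ⟶ b'} (hf : x.StartsWith f)
    (hg : x.StartsWith g) (h : G.d f = G.d g) : Arrow.mk f = Arrow.mk g := by
  obtain ⟨⟨p, hp'⟩, hp⟩ := hf
  obtain ⟨⟨q, hq'⟩, hq⟩ := hg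
  cases hp
  cases hq
  rw [d_map_toZero, d_map_toZero] at h
  dsimp only at h
  subst h
  rfl

theorem StartsWith.of_comp {a b c : Λ} {f : a ⟶ b} {g : b ⟶ c} (h : x.StartsWith (f ≫ g)) :
    x.StartsWith g := by
  have h' : toENat (G.d g) ≤ x.deg :=
    (toENat_le_toENat.2 (by rw [G.d_comp]; exact le_add_self)).trans h.d_le
  obtain ⟨p, hp⟩ := h
  have hd : p.val = G.d f + G.d g := by
    rw [← d_map_toZero, ← G.d_comp]
    exact congrArg (fun s : Arrow Λ => G.d s.hom) hp
  let q : Omega x.deg := ⟨G.d g, h'⟩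
  have hqp : q.val ≤ p.val := hd ▸ le_add_self
  refine ⟨q, ?_⟩
  have e : x.toFunctor.map (Omega.toZero p) =
      x.toFunctor.map (X := p) (Y := q) ⟨hqp⟩ ≫ x.toFunctor.map (Omega.toZero q) :=
    x.toFunctor.map_comp _ _
  rw [e] at hp
  refine G.initial_unique hp (x.d_map_toZero q) ?_
  rw [x.d_map, hd]
  exact add_tsub_cancel_right _ _

/-- Two initial segments of a path have a common extension which is an initial segment. -/
theorem StartsWith.exists_sup {a b c : Λ} {f : a ⟶ c} {g : b ⟶ c} (hf : x.StartsWith f)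
    (hg : x.StartsWith g) : ∃ (e : Λ) (t : e ⟶ a) (t' : e ⟶ b), t ≫ f = t' ≫ g ∧
      x.StartsWith (t ≫ f) ∧ G.d (t ≫ f) = G.d f ⊔ G.d g := by
  have hd : toENat (G.d f ⊔ G.d g) ≤ x.deg := by
    intro i
    change ((max (G.d f i) (G.d g i) : ℕ) : ℕ∞) ≤ x.deg i
    rcases max_choice (G.d f i) (G.d g i) with h | h <;> rw [h]
    exacts [hf.d_le i, hg.d_le i]
  obtain ⟨e, F, hF, hF'⟩ := x.exists_startsWith hd
  obtain rfl := hf.range_eq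
  obtain ⟨t, ht⟩ := hf.exists_comp_eq hF (hF' ▸ le_sup_left)
  obtain ⟨t', ht'⟩ := hg.exists_comp_eq hF (hF' ▸ le_sup_right)
  exact ⟨e, t, t', ht.trans ht'.symm, ht ▸ hF, ht ▸ hF'⟩

/-- A path is determined by its initial segments. -/
theorem ext_startsWith (h : ∀ (a b : Λ) (f : a ⟶ b), x.StartsWith f ↔ y.StartsWith f) : x = y := by
  have hdeg : ∀ p, toENat p ≤ x.deg ↔ toENat p ≤ y.deg := by
    intro p
    constructor
    · intro hp
      obtain ⟨a, f, hf, rfl⟩ := x.exists_startsWith hp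
      exact ((h _ _ f).1 hf).d_le
    · intro hp
      obtain ⟨a, f, hf, rfl⟩ := y.exists_startsWith hp
      exact ((h _ _ f).2 hf).d_le
  have hle : ∀ {m m' : Fin k → ℕ∞}, (∀ p, toENat p ≤ m → toENat p ≤ m') → m ≤ m' := by
    intro m m' hm i
    refine ENat.forall_natCast_le_iff_le.1 fun n hn => ?_
    have := hm (Pi.single i n) (fun j => by
      by_cases hj : j = i
      · subst hj; simpa [toENat] using hn
      · simp [toENat, hj]) i
    simpa [toENat] using this
  refine eq_of_initial_eq (le_antisymm (hle fun p => (hdeg p).1) (hle fun p => (hdeg p).2)) ?_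
  intro p hx hy
  refine ((h _ _ _).1 (x.startsWith_map ⟨p, hx⟩)).arrow_eq (y.startsWith_map ⟨p, hy⟩) ?_
  rw [d_map_toZero, d_map_toZero]

theorem StartsWith.shift_range_eq {a b : Λ} {f : a ⟶ b} (hf : x.StartsWith f) {n : Fin k → ℕ}
    (hn : toENat n ≤ x.deg) (h : G.d f = n) : (x.shift n hn).range = a := by
  have := hf.arrow_eq (x.startsWith_map ⟨n, hn⟩) (by rw [h, d_map_toZero])
  exact (congrArg (fun s : Arrow Λ => s.left) this).symm

theorem StartsWith.startsWith_shift_iff {a b : Λ} {f : a ⟶ b} (hf : x.StartsWith f)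
    {n : Fin k → ℕ} (hn : toENat n ≤ x.deg) (h : G.d f = n) {c : Λ} (g : c ⟶ a) :
    (x.shift n hn).StartsWith g ↔ x.StartsWith (g ≫ f) := by
  have e := hf.arrow_eq (x.startsWith_map ⟨n, hn⟩) (by rw [h, d_map_toZero])
  cases e
  have key : ∀ q : Omega (x.shift n hn).deg,
      x.toFunctor.map (Omega.toZero ((Omega.translate x.deg n hn).obj q)) =
        (x.shift n hn).toFunctor.map (Omega.toZero q) ≫
          x.toFunctor.map (Omega.toZero ⟨n, hn⟩) :=
    fun q => x.toFunctor.map_comp (X := (Omega.translate x.deg n hn).obj q)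
      (Y := ⟨n, hn⟩) (Z := Omega.zero _) ⟨fun i => Nat.le_add_right _ _⟩ ⟨fun i => Nat.zero_le _⟩
  constructor
  · rintro ⟨q, hq⟩
    refine ⟨(Omega.translate x.deg n hn).obj q, ?_⟩
    rw [key]
    cases hq
    rfl
  · intro hg
    have hle := hg.d_le
    have hq : toENat (G.d g) ≤ (x.shift n hn).deg := by
      intro i
      have := hle i
      rw [G.d_comp, d_map_toZero] at this
      refine ENat.le_sub_of_add_le_right (ENat.natCast_ne_top _) ?_
      simpa [toENat] using this
    refine ⟨⟨_, hq⟩, ?_⟩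
    have e := (x.startsWith_map ((Omega.translate x.deg n hn).obj ⟨_, hq⟩)).arrow_eq hg (by
      rw [d_map_toZero, G.d_comp, d_map_toZero]
      exact add_comm _ _)
    have e := (congrArg Arrow.mk (key ⟨_, hq⟩)).symm.trans e
    exact G.terminal_unique e rfl ((x.shift n hn).d_map_toZero _)

/-- `σ^m x = σ^n x` means that `x(0, m)` and `x(0, n)` have the same source and are continued in
`x` by the same finite paths. -/
theorem shift_eq_shift_iff {m n : Fin k → ℕ} (hm : toENat m ≤ x.deg) (hn : toENat n ≤ x.deg) :
    x.shift m hm = x.shift n hn ↔ ∃ (a b : Λ) (f g : a ⟶ b), x.StartsWith f ∧ x.StartsWith g ∧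
      G.d f = m ∧ G.d g = n ∧
        ∀ (c : Λ) (h : c ⟶ a), x.StartsWith (h ≫ f) ↔ x.StartsWith (h ≫ g) := by
  constructor
  · intro e
    obtain ⟨a, f, hf, hfm⟩ := x.exists_startsWith hm
    obtain ⟨a', g, hg, hgn⟩ := x.exists_startsWith hn
    obtain rfl : a = a' := by
      rw [← hf.shift_range_eq hm hfm, ← hg.shift_range_eq hn hgn, e]
    refine ⟨a, _, f, g, hf, hg, hfm, hgn, fun c h => ?_⟩
    rw [← hf.startsWith_shift_iff hm hfm, ← hg.startsWith_shift_iff hn hgn, e]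
  · rintro ⟨a, b, f, g, hf, hg, hfm, hgn, h⟩
    refine ext_startsWith fun c a' l => ?_
    have key : ∀ {a' : Λ} (l : c ⟶ a'), a' = a →
        ((x.shift m hm).StartsWith l ↔ (x.shift n hn).StartsWith l) := by
      rintro _ l rfl
      rw [hf.startsWith_shift_iff hm hfm, hg.startsWith_shift_iff hn hgn, h]
    constructor
    · intro hl
      exact (key l (hl.range_eq.symm.trans (hf.shift_range_eq hm hfm))).1 hl
    · intro hl
      exact (key l (hl.range_eq.symm.trans (hg.shift_range_eq hn hgn))).2 hl

/-- The defining property of a boundary path, in terms of its initial segments. -/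
theorem isBoundary_iff : x.IsBoundary ↔ ∀ ⦃a b : Λ⦄ (f : a ⟶ b), x.StartsWith f →
    ∀ E : Set ((c : Λ) × (c ⟶ a)), E.Finite → G.Exhaustive E →
      ∃ g ∈ E, x.StartsWith (g.2 ≫ f) := by
  have key : ∀ (n : Fin k → ℕ) (hn : toENat n ≤ x.deg)
      (g : (a : Λ) × (a ⟶ x.vertex n hn)), x.StartsWith (g.2 ≫ x.toFunctor.map
        (Omega.toZero ⟨n, hn⟩)) ↔ ∃ h : toENat (n + G.d g.2) ≤ x.deg,
          (⟨x.vertex (n + G.d g.2) h, x.segment n (n + G.d g.2) hn h le_self_add⟩ :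
            (a : Λ) × (a ⟶ x.vertex n hn)) = g := by
    intro n hn g
    have hfac : ∀ h : toENat (n + G.d g.2) ≤ x.deg,
        x.toFunctor.map (Omega.toZero ⟨n + G.d g.2, h⟩) =
          x.segment n (n + G.d g.2) hn h le_self_add ≫ x.toFunctor.map (Omega.toZero ⟨n, hn⟩) :=
      fun h => x.toFunctor.map_comp _ _
    constructor
    · intro hs
      have h : toENat (n + G.d g.2) ≤ x.deg := by
        have := hs.d_le
        rwa [G.d_comp, d_map_toZero, add_comm] at this
      refine ⟨h, ?_⟩
      have e := (x.startsWith_map ⟨_, h⟩).arrow_eq hs (by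
        rw [d_map_toZero, G.d_comp, d_map_toZero]
        exact add_comm _ _)
      rw [hfac] at e
      have e' := G.terminal_unique e rfl (by
        rw [segment, x.d_map]; exact add_tsub_cancel_left _ _)
      exact sigma_mk_eq_of_arrow_eq e'
    · rintro ⟨h, e⟩
      refine ⟨⟨_, h⟩, ?_⟩
      rw [hfac]
      exact congrArg (fun s : (a : Λ) × (a ⟶ x.vertex n hn) =>
        Arrow.mk (s.2 ≫ x.toFunctor.map (Omega.toZero ⟨n, hn⟩))) e
  constructor
  · rintro h a b f ⟨p, hp⟩ E hE hE'
    cases hp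
    obtain ⟨g, hg, hg'⟩ := h p.val p.le E hE hE'
    exact ⟨g, hg, (key p.val p.le g).2 hg'⟩
  · intro h n hn E hE hE'
    obtain ⟨g, hg, hg'⟩ := h _ (x.startsWith_map ⟨n, hn⟩) E hE hE'
    exact ⟨g, hg, (key n hn g).1 hg'⟩

theorem IsConcat.startsWith {w : Λ} {f : x.range ⟶ w} (h : x.IsConcat f y) : y.StartsWith f :=
  ⟨_, h.choose_spec.1⟩

theorem IsConcat.startsWith_iff {w : Λ} {f : x.range ⟶ w} (h : x.IsConcat f y) {a : Λ}
    (g : a ⟶ x.range) : y.StartsWith (g ≫ f) ↔ x.StartsWith g := by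
  have h' := h.startsWith
  obtain ⟨h1, -, h3⟩ := h
  rw [← h'.startsWith_shift_iff h1 rfl, h3]

theorem isConcat_of_shift_eq {w : Λ} {f : x.range ⟶ w} {n : Fin k → ℕ} (hf : y.StartsWith f)
    (hn : toENat n ≤ y.deg) (hd : G.d f = n) (h : y.shift n hn = x) : x.IsConcat f y := by
  subst hd
  exact ⟨hn, (y.startsWith_map _).arrow_eq hf (d_map_toZero _ _), h⟩

theorem IsBoundary.of_isConcat (hG : G.FinitelyAligned) {w : Λ} {f : x.range ⟶ w}
    (hx : x.IsBoundary) (h : x.IsConcat f y) : y.IsBoundary := by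
  refine isBoundary_iff.2 fun a b l hl E hE hE' => ?_
  obtain rfl : b = w := hl.range_eq.symm.trans h.startsWith.range_eq
  obtain ⟨e, t, t', h1, h2, -⟩ := hl.exists_sup h.startsWith
  obtain ⟨E₁, hfin, hexh, hE₁⟩ := hE'.exists_pullback hG hE t
  rw [h1, h.startsWith_iff] at h2
  obtain ⟨β, hβ, hβ'⟩ := isBoundary_iff.1 hx t' h2 E₁ hfin hexh
  obtain ⟨g, hg, γ, hγ⟩ := hE₁ β hβ
  refine ⟨g, hg, StartsWith.of_comp (f := γ) ?_⟩
  rw [← Category.assoc, ← hγ, Category.assoc, h1, ← Category.assoc]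
  exact (h.startsWith_iff _).2 hβ'

end Path
end KGraph

namespace KGraph

variable {k : ℕ} {Λ : Type u} [Category.{v} Λ]

namespace Path

variable {G : KGraph k Λ}

/-! ### Paths from directed families of finite paths -/

theorem exists_le_d_of_directed (G : KGraph k Λ) {w : Λ} {S : Set ((a : Λ) × (a ⟶ w))}
    (hne : S.Nonempty)
    (hdir : ∀ f ∈ S, ∀ g ∈ S, ∃ (e : Λ) (t : e ⟶ f.1) (t' : e ⟶ g.1),
      t ≫ f.2 = t' ≫ g.2 ∧ (⟨e, t ≫ f.2⟩ : (a : Λ) × (a ⟶ w)) ∈ S)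
    {p : Fin k → ℕ} (hp : ∀ i, (p i : ℕ∞) ≤ ⨆ f : S, (G.d f.1.2 i : ℕ∞)) :
    ∃ f ∈ S, p ≤ G.d f.2 := by
  have hone : ∀ i, ∃ f ∈ S, p i ≤ G.d f.2 i := by
    intro i
    by_contra! hlt
    obtain ⟨f, hf⟩ := hne
    have h0 := hlt f hf
    have h1 : (⨆ f : S, (G.d f.1.2 i : ℕ∞)) ≤ ((p i - 1 : ℕ) : ℕ∞) :=
      iSup_le fun g => Nat.cast_le.2 (Nat.le_sub_one_of_lt (hlt g.1 g.2))
    have h2 := Nat.cast_le.1 ((hp i).trans h1)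
    omega
  have hfin : ∀ s : Finset (Fin k), ∃ f ∈ S, ∀ i ∈ s, p i ≤ G.d f.2 i := by
    intro s
    induction s using Finset.induction_on with
    | empty =>
      obtain ⟨f, hf⟩ := hne
      exact ⟨f, hf, by simp⟩
    | insert j s _ ih =>
      obtain ⟨f, hf, hf'⟩ := ih
      obtain ⟨g, hg, hg'⟩ := hone j
      obtain ⟨e, t, t', h1, h2⟩ := hdir f hf g hg
      refine ⟨_, h2, fun i hi => ?_⟩
      rcases Finset.mem_insert.1 hi with rfl | hi
      · refine hg'.trans ?_
        dsimp only
        rw [h1, G.d_comp]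
        exact le_add_self (a := G.d g.2 i)
      · refine (hf' i hi).trans ?_
        dsimp only
        rw [G.d_comp]
        exact le_add_self (a := G.d f.2 i)
  obtain ⟨f, hf, h⟩ := hfin Finset.univ
  exact ⟨f, hf, fun i => h i (Finset.mem_univ i)⟩

/-- A nonempty family of finite paths with range `w` which is directed under extension and closed
under initial segments is the family of initial segments of a path. The degree of this path is the
supremum of the degrees in the family. -/
theorem exists_startsWith_iff_mem (G : KGraph k Λ) {w : Λ} {S : Set ((a : Λ) × (a ⟶ w))}
    (hne : S.Nonempty)
    (hlow : ∀ ⦃a b : Λ⦄ (h : b ⟶ a) (f : a ⟶ w),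
      (⟨b, h ≫ f⟩ : (a : Λ) × (a ⟶ w)) ∈ S → (⟨a, f⟩ : (a : Λ) × (a ⟶ w)) ∈ S)
    (hdir : ∀ f ∈ S, ∀ g ∈ S, ∃ (e : Λ) (t : e ⟶ f.1) (t' : e ⟶ g.1),
      t ≫ f.2 = t' ≫ g.2 ∧ (⟨e, t ≫ f.2⟩ : (a : Λ) × (a ⟶ w)) ∈ S) :
    ∃ x : G.Path, x.range = w ∧
      ∀ (a : Λ) (f : a ⟶ w), x.StartsWith f ↔ (⟨a, f⟩ : (a : Λ) × (a ⟶ w)) ∈ S := by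
  let m : Fin k → ℕ∞ := fun i => ⨆ f : S, (G.d f.1.2 i : ℕ∞)
  have hle : ∀ f ∈ S, toENat (G.d f.2) ≤ m := fun f hf i =>
    le_iSup (fun f : S => (G.d f.1.2 i : ℕ∞)) ⟨f, hf⟩
  have hex : ∀ p : Omega m, ∃ t ∈ S, G.d t.2 = p.val := by
    intro p
    obtain ⟨f, hf, hpf⟩ := exists_le_d_of_directed G hne hdir p.le
    obtain ⟨c, h, g, h1, h2⟩ := G.exists_factor f.2 hpf
    exact ⟨⟨c, h⟩, hlow g h (by rw [h1]; exact hf), h2⟩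
  choose t ht htd using hex
  have hcomp : ∀ f ∈ S, ∀ g ∈ S, G.d f.2 ≤ G.d g.2 → ∃ s : g.1 ⟶ f.1, s ≫ f.2 = g.2 := by
    intro f hf g hg h
    obtain ⟨e, s, s', h1, -⟩ := hdir f hf g hg
    exact G.exists_between h1.symm h
  choose g hg using fun (q p : Omega m) (h : p.val ≤ q.val) =>
    hcomp (t p) (ht p) (t q) (ht q) (by rwa [htd, htd])
  let F : Omega m ⥤ Λ :=
    { obj := fun p => (t p).1
      map := fun {q p} e => g q p e.down
      map_id := fun p => G.cancel (h := (t p).2) (by rw [hg, Category.id_comp])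
      map_comp := fun {a b c} e e' => G.cancel (h := (t c).2) (by
        rw [hg, Category.assoc, hg, hg]) }
  have hF : ∀ {q p : Omega m} (e : q ⟶ p), F.map e ≫ (t p).2 = (t q).2 :=
    fun e => hg _ _ e.down
  let x : G.Path :=
    { deg := m
      toFunctor := F
      d_map := fun {q p} e => by
        have := congrArg G.d (hF e)
        rw [G.d_comp, htd, htd] at this
        rw [← this, add_tsub_cancel_right] }
  have hinit : ∀ p : Omega m, Arrow.mk (x.toFunctor.map (Omega.toZero p)) = Arrow.mk (t p).2 := by
    intro p
    rw [← hF (Omega.toZero p)]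
    exact (G.comp_eq_left _ (htd _)).symm
  refine ⟨x, ?_, fun a f => ?_⟩
  · exact congrArg (fun s : Arrow Λ => s.right)
      ((hinit (Omega.zero m)))
  · constructor
    · rintro ⟨p, hp⟩
      rw [hinit] at hp
      have : t p = ⟨a, f⟩ := sigma_mk_eq_of_arrow_eq (g := ⟨a, f⟩) hp
      exact this ▸ ht p
    · intro hf
      refine ⟨⟨G.d f, hle _ hf⟩, ?_⟩
      rw [hinit]
      obtain ⟨s, hs⟩ := hcomp ⟨a, f⟩ hf _ (ht ⟨G.d f, hle _ hf⟩) (htd ⟨G.d f, hle _ hf⟩).ge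
      rw [← hs]
      refine G.comp_eq_right _ ?_
      have := congrArg G.d hs
      rw [G.d_comp, htd] at this
      exact left_eq_add.1 (by rw [add_comm]; exact this.symm)

end Path

/-! ### Dense requirements on finite paths -/

/-- The finite paths with range `w`, preordered by extension: longer paths are larger. -/
def FinitePath (w : Λ) : Type (max u v) := (a : Λ) × (a ⟶ w)

instance (w : Λ) : Preorder (FinitePath w) where
  le f g := ∃ h : g.1 ⟶ f.1, h ≫ f.2 = g.2
  le_refl f := ⟨𝟙 _, Category.id_comp _⟩
  le_trans := by
    rintro f g l ⟨h, hh⟩ ⟨h', hh'⟩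
    exact ⟨h' ≫ h, by rw [Category.assoc, hh, hh']⟩

/-- Given countably many cofinal sets of finite paths with range `w`, some path has an initial segment
in each of them. This is the Rasiowa–Sikorski lemma: the initial segments of the path are a generic
ideal. -/
theorem exists_path_of_countable_cofinal (G : KGraph k Λ) (w : Λ) {ι : Type*} [Countable ι]
    (D : ι → Set (FinitePath w)) (hD : ∀ i, IsCofinal (D i)) :
    ∃ x : G.Path, x.range = w ∧ ∀ i, ∃ f ∈ D i, x.StartsWith f.2 := by
  have := Encodable.ofCountable ι
  let v : FinitePath w := ⟨w, 𝟙 w⟩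
  let I : Order.Ideal (FinitePath w) := Order.idealOfCofinals v fun i => ⟨D i, hD i⟩
  obtain ⟨x, hx, hx'⟩ := Path.exists_startsWith_iff_mem G (S := (I : Set (FinitePath w)))
    ⟨v, Order.mem_idealOfCofinals v _⟩ (fun a b h f hf => I.lower ⟨h, rfl⟩ hf) (by
      intro f hf g hg
      obtain ⟨l, hl, ⟨t, ht⟩, ⟨t', ht'⟩⟩ := I.directed f hf g hg
      refine ⟨l.1, t, t', ht.trans ht'.symm, ?_⟩
      rw [ht]
      exact hl)
  refine ⟨x, hx, fun i => ?_⟩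
  obtain ⟨f, hf, hf'⟩ := Order.cofinal_meets_idealOfCofinals v
    (fun i => ⟨D i, hD i⟩) i
  exact ⟨f, hf, (hx' f.1 f.2).2 hf'⟩

end KGraph

namespace KGraph

variable {k : ℕ} {Λ : Type u} [Category.{v} Λ] {G : KGraph k Λ}

/-! ### Condition B -/

theorem AperiodicityCondition.conditionB (h : G.AperiodicityCondition) : G.ConditionB := by
  intro w
  obtain ⟨x, hx, hw, hap⟩ := h w
  refine ⟨x, hx, hw, fun a b f g hne e => hne ?_⟩
  have hf := x.isConcat_concat f
  have hg := x.isConcat_concat g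
  rw [← e] at hg
  obtain rfl : a = b := hf.startsWith.range_eq.symm.trans hg.startsWith.range_eq
  -- the common extension `h ≫ f = h' ≫ g` inside `f x = g x` gives `σ^{d(h)} x = σ^{d(h')} x`
  obtain ⟨c, h, h', h1, h2, -⟩ := hf.startsWith.exists_sup hg.startsWith
  have hh : x.StartsWith h := (hf.startsWith_iff h).1 h2
  have hh' : x.StartsWith h' := (hg.startsWith_iff h').1 (h1 ▸ h2)
  have hd := hap _ _ hh.d_le hh'.d_le ((Path.shift_eq_shift_iff _ _).2
    ⟨c, _, h, h', hh, hh', rfl, rfl, fun b l => by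
      rw [← hf.startsWith_iff, ← hg.startsWith_iff, Category.assoc, Category.assoc, h1]⟩)
  refine hf.startsWith.arrow_eq hg.startsWith ?_
  have := congrArg G.d h1
  rw [G.d_comp, G.d_comp, hd] at this
  exact add_left_cancel this

theorem ConditionB.noLocalPeriodicity (hG : G.FinitelyAligned) (h : G.ConditionB) :
    G.NoLocalPeriodicity := by
  intro w m n hmn
  by_contra! hper
  obtain ⟨x, hx, rfl, -⟩ := h w
  have hle : ∀ {y : G.Path}, toENat (m ⊔ n) ≤ y.deg → toENat m ≤ y.deg ∧ toENat n ≤ y.deg :=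
    fun h => ⟨(toENat_le_toENat.2 le_sup_left).trans h, (toENat_le_toENat.2 le_sup_right).trans h⟩
  obtain ⟨a, f, -, hfm⟩ := x.exists_startsWith (hle (hper x hx rfl).1).1
  obtain ⟨z, hz, rfl, hB⟩ := h a
  have hy := z.isConcat_concat f
  obtain ⟨h1, h2⟩ := hper _ (hz.of_isConcat hG hy) hy.startsWith.range_eq
  obtain ⟨hm, hn⟩ := hle h1
  have hzm : (z.concat f).shift m hm = z := by
    obtain ⟨_, -, h3⟩ := hy
    subst hfm
    exact h3
  -- `z = σ^m (f z) = σ^n (f z)`, so that `f z = g z` where `g` is the segment of degree `n`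
  obtain ⟨c, b, f', g, hf', hg, hd, hd', -⟩ := (Path.shift_eq_shift_iff hm hn).1 (h2 hm hn)
  obtain rfl : z.range = c := by
    rw [← hf'.shift_range_eq hm hd, hzm]
  have hg' := Path.isConcat_of_shift_eq hg hn hd' ((h2 hm hn).symm.trans hzm)
  refine hB f g (fun e => hmn ?_) (hg'.unique (z.isConcat_concat g))
  rw [← hfm, ← hd']
  exact congrArg (fun s : Arrow Λ => G.d s.hom) e

/-! ### Periodicity is a closed condition -/

/-- Periodicity is a closed condition on boundary paths through `f`: if every extension of `f` is
an initial segment of a path in which all continuations of `p` are continuations of `q`, then the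
same holds in every boundary path through `f`. Finite alignment enters here: the minimal common
extensions of a segment `τ` of `x` and the path `μ = q l` that `x` should follow form
a finite exhaustive set. -/
theorem Path.IsBoundary.startsWith_of_forall_extension (hG : G.FinitelyAligned) {x : G.Path}
    (hx : x.IsBoundary) {a b c : Λ} {f : a ⟶ b} (hf : x.StartsWith f) {p q : c ⟶ b}
    (H : ∀ ⦃e : Λ⦄ (h : e ⟶ a), ∃ z : G.Path, z.StartsWith (h ≫ f) ∧
      ∀ (e' : Λ) (l : e' ⟶ c), z.StartsWith (l ≫ p) → z.StartsWith (l ≫ q))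
    {e : Λ} {l : e ⟶ c} (hl : x.StartsWith (l ≫ p)) : x.StartsWith (l ≫ q) := by
  obtain ⟨e₁, t, t', h1, h2, -⟩ := hf.exists_sup hl
  let M := G.minExt (t ≫ f) (l ≫ q)
  obtain ⟨g, hg, hg'⟩ := Path.isBoundary_iff.1 hx (t ≫ f) h2
    ((fun s : (e' : Λ) × ((e' ⟶ e₁) × (e' ⟶ e)) => (⟨s.1, s.2.1⟩ : (c : Λ) × (c ⟶ e₁))) '' M)
    ((hG _ _).image _) (by
      intro b' α
      obtain ⟨z, hz, hz'⟩ := H (α ≫ t)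
      have hzl : z.StartsWith (l ≫ q) := by
        refine hz' _ l (Path.StartsWith.of_comp (f := α ≫ t') ?_)
        rwa [Category.assoc, ← h1, ← Category.assoc]
      rw [Category.assoc] at hz
      obtain ⟨e₂, s, s', h3, -, -⟩ := hz.exists_sup hzl
      obtain ⟨e₃, β, γ, r, h4, h5, h6, -⟩ := G.exists_minimal_extension
        (f := t ≫ f) (g := l ≫ q) (t := s ≫ α) (t' := s') (by rw [Category.assoc, h3])
      exact ⟨_, ⟨⟨e₃, β, γ⟩, ⟨h4, h5⟩, rfl⟩, G.minExt_nonempty (t := r) (t' := s) h6⟩)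
  obtain ⟨⟨e', β, γ⟩, ⟨h3, -⟩, rfl⟩ := hg
  dsimp only at hg' h3
  rw [h3] at hg'
  exact hg'.of_comp

/-- If `σ^m x = σ^n x` and the degree of the initial segment `f` of `x = f y` is at least `m ∨ n`,
then `y` is periodic as well, with `m` and `n` diminished by `m ∧ n`. The degree of `x` is infinite
in all directions in which `m` and `n` differ, so that `y` is long enough. -/
theorem Path.shift_eq_shift_of_isConcat {x y : G.Path} {w : Λ} {f : y.range ⟶ w}
    (hxy : y.IsConcat f x) {m n : Fin k → ℕ} (hf : m ⊔ n ≤ G.d f)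
    (hm : toENat m ≤ x.deg) (hn : toENat n ≤ x.deg) (h : x.shift m hm = x.shift n hn) :
    toENat ((m - m ⊓ n) ⊔ (n - m ⊓ n)) ≤ y.deg ∧
      ∀ (hm' : toENat (m - m ⊓ n) ≤ y.deg) (hn' : toENat (n - m ⊓ n) ≤ y.deg),
        y.shift _ hm' = y.shift _ hn' := by
  constructor
  · intro i
    have hdeg : x.deg i - (m i : ℕ∞) = x.deg i - (n i : ℕ∞) :=
      congrFun (congrArg Path.deg h) i
    have hxi : x.deg i = (G.d f i : ℕ∞) + y.deg i := congrFun hxy.deg_eq i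
    have hfi : max (m i) (n i) ≤ G.d f i := hf i
    change ((max (m i - min (m i) (n i)) (n i - min (m i) (n i)) : ℕ) : ℕ∞) ≤ y.deg i
    rw [hxi] at hdeg
    generalize y.deg i = r at *
    cases r with
    | top => exact le_top
    | coe r =>
      norm_cast at hdeg ⊢
      have : G.d f i + r - m i = G.d f i + r - n i := by exact_mod_cast hdeg
      omega
  · intro hm' hn'
    obtain ⟨c, b, fm, gn, hfm, hgn, hd, hd', hper⟩ := (shift_eq_shift_iff hm hn).1 h
    obtain rfl : w = b := hxy.startsWith.range_eq.symm.trans hfm.range_eq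
    obtain ⟨a₁, p, hp, hpd⟩ := y.exists_startsWith hm'
    obtain ⟨a₂, q, hq, hqd⟩ := y.exists_startsWith hn'
    have hp' := (hxy.startsWith_iff p).2 hp
    have hq' := (hxy.startsWith_iff q).2 hq
    have hle : ∀ i, max (m i) (n i) ≤ G.d f i := hf
    obtain ⟨r, hr⟩ := hfm.exists_comp_eq hp' (by
      intro i
      have := hle i
      rw [hd, G.d_comp]
      exact ((le_max_left _ _).trans this).trans (le_add_self (a := G.d f i)))
    obtain ⟨s, hs⟩ := hgn.exists_comp_eq hq' (by
      intro i
      have := hle i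
      rw [hd', G.d_comp]
      exact ((le_max_right _ _).trans this).trans (le_add_self (a := G.d f i)))
    have hrs : G.d r = G.d s := by
      funext i
      have e1 := congrFun (congrArg G.d hr) i
      have e2 := congrFun (congrArg G.d hs) i
      have e3 := congrFun hpd i
      have e4 := congrFun hqd i
      have := hle i
      simp only [G.d_comp, hd, hd', Pi.add_apply, Pi.sub_apply, Pi.inf_apply] at e1 e2 e3 e4
      omega
    have hrx : x.StartsWith (r ≫ gn) := (hper _ r).1 (hr ▸ hp')
    have e := hrx.arrow_eq (hs ▸ hq' : x.StartsWith (s ≫ gn)) (by rw [G.d_comp, G.d_comp, hrs])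
    obtain ⟨rfl, -, -⟩ := (Arrow.mk_eq_mk_iff _ _).1 e
    obtain rfl : r = s := G.cancel (Arrow.mk_injective _ _ e)
    refine (shift_eq_shift_iff hm' hn').2 ⟨a₁, _, p, q, hp, hq, hpd, hqd, fun c l => ?_⟩
    rw [← hxy.startsWith_iff, ← hxy.startsWith_iff, Category.assoc, Category.assoc, ← hr, ← hs,
      ← Category.assoc, ← Category.assoc, hper]

/-- Without local periodicity, every finite path `f` with `d(f) ≥ m ∨ n` has an extension through which
no path `x` satisfies `σ^m x = σ^n x`. Otherwise periodic paths would be dense among the paths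
through `f`, so that all boundary paths `f y` would be periodic, and hence also all `y`. -/
theorem NoLocalPeriodicity.exists_extension (hG : G.FinitelyAligned) (h : G.NoLocalPeriodicity)
    {m n : Fin k → ℕ} (hmn : m ≠ n) {a w : Λ} (f : a ⟶ w) (hf : m ⊔ n ≤ G.d f) :
    ∃ (b : Λ) (t : b ⟶ a), ∀ x : G.Path, x.StartsWith (t ≫ f) →
      ∀ (hm : toENat m ≤ x.deg) (hn : toENat n ≤ x.deg), x.shift m hm ≠ x.shift n hn := by
  by_contra! H
  have hne : m - m ⊓ n ≠ n - m ⊓ n := fun e => hmn <| by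
    funext i
    have := congrFun e i
    simp only [Pi.sub_apply, Pi.inf_apply] at this
    omega
  obtain ⟨y, hy, rfl, hy'⟩ := h a _ _ hne
  have hx := y.isConcat_concat f
  have hxb := hy.of_isConcat hG hx
  have hle : toENat (m ⊔ n) ≤ (y.concat f).deg :=
    (toENat_le_toENat.2 hf).trans hx.startsWith.d_le
  have hm := (toENat_le_toENat.2 (le_sup_left (a := m) (b := n))).trans hle
  have hn := (toENat_le_toENat.2 (le_sup_right (a := m) (b := n))).trans hle
  obtain ⟨c, p, r, hp, hpd⟩ := G.exists_factor f (le_sup_left.trans hf)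
  obtain ⟨c', q, r', hq, hqd⟩ := G.exists_factor f (le_sup_right.trans hf)
  -- the segments of degrees `m` and `n` of the periodic extensions of `f` are those of `f`
  have key : ∀ {b : Λ} (t : b ⟶ y.range), ∃ z : G.Path, z.StartsWith (t ≫ f) ∧
      ∃ e : c = c', ∀ (e' : Λ) (l : e' ⟶ c),
        z.StartsWith (l ≫ p) ↔ z.StartsWith (l ≫ eqToHom e ≫ q) := by
    intro b t
    obtain ⟨z, hz, hzm, hzn, e⟩ := H b t
    have hzf := hz.of_comp
    have hzp : z.StartsWith p := Path.StartsWith.of_comp (f := r) (hp.symm ▸ hzf)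
    have hzq : z.StartsWith q := Path.StartsWith.of_comp (f := r') (hq.symm ▸ hzf)
    obtain rfl : c = c' := by
      rw [← hzp.shift_range_eq hzm hpd, ← hzq.shift_range_eq hzn hqd, e]
    refine ⟨z, hz, rfl, fun e' l => ?_⟩
    rw [eqToHom_refl, Category.id_comp, ← hzp.startsWith_shift_iff hzm hpd, e,
      hzq.startsWith_shift_iff hzn hqd]
  obtain ⟨-, -, rfl, -⟩ := key (𝟙 _)
  simp only [eqToHom_refl, Category.id_comp, exists_const] at key
  have hxp : (y.concat f).StartsWith p :=
    Path.StartsWith.of_comp (f := r) (hp.symm ▸ hx.startsWith)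
  have hxq : (y.concat f).StartsWith q :=
    Path.StartsWith.of_comp (f := r') (hq.symm ▸ hx.startsWith)
  have hper : (y.concat f).shift m hm = (y.concat f).shift n hn := by
    refine (Path.shift_eq_shift_iff hm hn).2 ⟨c, w, p, q, hxp, hxq, hpd, hqd, fun e l => ⟨?_, ?_⟩⟩
    · refine hxb.startsWith_of_forall_extension hG hx.startsWith fun b t => ?_
      obtain ⟨z, hz, hz'⟩ := key t
      exact ⟨z, hz, fun e l => (hz' e l).1⟩
    · refine hxb.startsWith_of_forall_extension hG hx.startsWith fun b t => ?_
      obtain ⟨z, hz, hz'⟩ := key t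
      exact ⟨z, hz, fun e l => (hz' e l).2⟩
  obtain ⟨h1, h2⟩ := Path.shift_eq_shift_of_isConcat hx hf hm hn hper
  rcases hy' with hy' | ⟨hm', hn', hy'⟩
  · exact hy' h1
  · exact hy' (h2 hm' hn')

/-! ### Aperiodic boundary paths -/

/-- The finite paths which decide the boundary condition at `g` for the set `E`: they are incompatible
with `g`, or extend the composite of `g` with an element of `E`, unless `E` is not exhaustive. -/
theorem isCofinal_boundary (G : KGraph k Λ) {w b : Λ} (g : b ⟶ w)
    (E : Set ((c : Λ) × (c ⟶ b))) :
    IsCofinal {f : FinitePath w | (¬ ∃ (e : Λ) (t : e ⟶ b) (t' : e ⟶ f.1), t ≫ g = t' ≫ f.2) ∨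
      ¬ G.Exhaustive E ∨ ∃ l ∈ E, ∃ t : f.1 ⟶ l.1, t ≫ l.2 ≫ g = f.2} := by
  intro f
  by_cases hc : ∃ (e : Λ) (t : e ⟶ b) (t' : e ⟶ f.1), t ≫ g = t' ≫ f.2
  · by_cases hE : G.Exhaustive E
    · obtain ⟨e, t, t', ht⟩ := hc
      obtain ⟨l, hl, ⟨e', α, β⟩, h, -⟩ := hE t
      dsimp only at h
      have key : α ≫ l.2 ≫ g = β ≫ t' ≫ f.2 := by
        rw [← Category.assoc, h, Category.assoc, ht]
      exact ⟨⟨e', β ≫ t' ≫ f.2⟩, Or.inr (Or.inr ⟨l, hl, α, key⟩), β ≫ t', Category.assoc _ _ _⟩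
    · exact ⟨f, Or.inr (Or.inl hE), le_rfl⟩
  · exact ⟨f, Or.inl hc, le_rfl⟩

/-- The finite paths which decide aperiodicity for the degrees `m` and `n`: either no path through
them satisfies `σ^m x = σ^n x`, or they have no extension of degree at least `m ∨ n`. -/
theorem NoLocalPeriodicity.isCofinal_aperiodic (hG : G.FinitelyAligned)
    (h : G.NoLocalPeriodicity) {m n : Fin k → ℕ} (hmn : m ≠ n) (w : Λ) :
    IsCofinal {f : FinitePath w | (¬ ∃ (b : Λ) (t : b ⟶ f.1), m ⊔ n ≤ G.d (t ≫ f.2)) ∨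
      ∀ x : G.Path, x.StartsWith f.2 →
        ∀ (hm : toENat m ≤ x.deg) (hn : toENat n ≤ x.deg), x.shift m hm ≠ x.shift n hn} := by
  intro f
  by_cases hc : ∃ (b : Λ) (t : b ⟶ f.1), m ⊔ n ≤ G.d (t ≫ f.2)
  · obtain ⟨b, t, ht⟩ := hc
    obtain ⟨c, s, hs⟩ := h.exists_extension hG hmn (t ≫ f.2) ht
    exact ⟨⟨c, s ≫ t ≫ f.2⟩, Or.inr hs, s ≫ t, Category.assoc _ _ _⟩
  · exact ⟨f, Or.inl hc, le_rfl⟩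

theorem NoLocalPeriodicity.aperiodicityCondition (hG : G.FinitelyAligned)
    (h : G.NoLocalPeriodicity) : G.AperiodicityCondition := by
  intro w
  have := G.countable_obj
  have := G.countable_hom
  let ι := ((b : Λ) × ((_ : b ⟶ w) × Finset ((c : Λ) × (c ⟶ b)))) ⊕
    {s : (Fin k → ℕ) × (Fin k → ℕ) // s.1 ≠ s.2}
  obtain ⟨x, rfl, hx⟩ := G.exists_path_of_countable_cofinal w (ι := ι)
    (Sum.elim (fun s => _) (fun s => _))
    (Sum.rec (fun s => G.isCofinal_boundary s.2.1 (s.2.2 : Set ((c : Λ) × (c ⟶ s.1))))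
      (fun s => h.isCofinal_aperiodic hG s.2 w))
  refine ⟨x, Path.isBoundary_iff.2 ?_, rfl, ?_⟩
  · intro a b g hg E hE hE'
    obtain rfl := hg.range_eq
    obtain ⟨f, hf, hf'⟩ := hx (Sum.inl ⟨a, g, hE.toFinset⟩)
    rcases hf with hf | hf | ⟨l, hl, t, ht⟩
    · obtain ⟨e, t, t', h1, -, -⟩ := hg.exists_sup hf'
      exact absurd ⟨e, t, t', h1⟩ hf
    · exact absurd (by simpa using hE') hf
    · rw [← ht] at hf'
      exact ⟨l, by simpa using hl, hf'.of_comp⟩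
  · intro m n hm hn e
    by_contra hmn
    obtain ⟨f, hf, hf'⟩ := hx (Sum.inr ⟨(m, n), hmn⟩)
    rcases hf with hf | hf
    · obtain ⟨a, p, hp, hpd⟩ := x.exists_startsWith hm
      obtain ⟨b, q, hq, hqd⟩ := x.exists_startsWith hn
      obtain ⟨c, t, t', h1, h2, h3⟩ := hp.exists_sup hq
      obtain ⟨c', s, s', h4, h5, h6⟩ := hf'.exists_sup h2
      refine hf ⟨c', s, ?_⟩
      rw [h6, h3, hpd, hqd]
      exact le_sup_right
    · exact hf x hf' hm hn e

end KGraph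

theorem mainTheorem5 {k : ℕ} {Λ : Type u} [Category.{v} Λ] (G : KGraph k Λ)
    (hG : G.FinitelyAligned) :
    List.TFAE [G.NoLocalPeriodicity, G.AperiodicityCondition, G.ConditionB] := by
  tfae_have 1 → 2 := fun h => h.aperiodicityCondition hG
  tfae_have 2 → 3 := fun h => h.conditionB
  tfae_have 3 → 1 := fun h => h.noLocalPeriodicity hG
  tfae_finish
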